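/- All logarithms are to base 2. For a graph $G$ and a total order $\prec$ on its vertex set, the ordered Ramsey number of $(G,\prec)$ is the least integer $N$ such that every colouring of the edges of the complete graph on $\{1<\dots<N\}$ with two colours contains a monochromatic copy of $G$ in which the vertices appear in the order $\prec$; let $\mathrm{min\text{-}\overline{R}}(G)$ be the minimum of these numbers over all orders $\prec$ of the vertices of $G$. For a real number $\rho>0$ and a positive integer $n$ with $\lceil\rho n\rceil$ even, a graph on $n$ vertices is called $\rho$-regular if each of its vertices has degree $\lfloor\rho\rfloor$ or $\lceil\rho\rceil$ and it has exactly $\lceil\rho n\rceil/2$ edges; let $G(\rho,n)$ be a uniformly random $\rho$-regular graph on the vertex set $\{1,\dots,n\}$. Let $(\varepsilon_n)_{n\ge1}$, $(\zeta_n)_{n\ge1}$ and $(\rho_n)_{n\ge1}$ be sequences of real numbers such that - $\varepsilon_n>0$ and $\zeta_n>0$ for all sufficiently large $n$, and $\zeta_n\to0$ as $n\to\infty$; - there is a constant $C$ with $1\le\rho_n\le C$ for all $n$; - $\lim_{n\to\infty}\left(\left(\tfrac12-\varepsilon_n\right)\rho_n-\zeta_n-1\right)n\log n=\infty$. Then,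 as $n\to\infty$ through the integers for which $\lceil\rho_n n\rceil$ is even, the probability that $$\mathrm{min\text{-}\overline{R}}(G(\rho_n,n))\ \ge\ \frac{\zeta_n\,n^{1+\varepsilon_n}}{2\log(1/\zeta_n)}$$ tends to $1$. -/

import Mathlib

open Filter Topology

/-- The colouring `χ` of the ordered complete graph on `Fin N` contains a copy of the ordered graph
`(G, ord)` all of whose edges have colour `k`. -/
def HasOrderedCopy {V : Type*} (ord : LinearOrder V) (G : SimpleGraph V) {N : ℕ}
    (χ : SimpleGraph.TopEdgeLabeling (Fin N) Bool) (k : Bool) : Prop :=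
  ∃ f : V → Fin N, (∀ u v : V, ord.lt u v → f u < f v) ∧
    ∀ u v : V, G.Adj u v → (χ.labelGraph k).Adj (f u) (f v)

/-- The ordered Ramsey number of the ordered graph `(G, ord)`: the least `N` such that every
red/blue colouring of the edges of the ordered complete graph on `N` vertices contains a
monochromatic ordered copy of `(G, ord)`. -/
noncomputable def orderedRamsey {V : Type*} (ord : LinearOrder V) (G : SimpleGraph V) : ℕ :=
  sInf {N : ℕ | ∀ χ : SimpleGraph.TopEdgeLabeling (Fin N) Bool, ∃ k : Bool,
    HasOrderedCopy ord G χ k}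

/-- The minimum of the ordered Ramsey numbers of all orderings of `G`. -/
noncomputable def minOrderedRamsey {V : Type*} (G : SimpleGraph V) : ℕ :=
  sInf {r : ℕ | ∃ ord : LinearOrder V, r = orderedRamsey ord G}

open Classical in
/-- `ρ`-regular graphs on `n` vertices for real `ρ > 0`: all degrees are `⌊ρ⌋` or `⌈ρ⌉`, and there
are `⌈ρ n⌉ / 2` edges (so there are none unless `⌈ρ n⌉` is even). -/
def IsRealRegular (ρ : ℝ) {n : ℕ} (G : SimpleGraph (Fin n)) : Prop :=
  (∀ v, G.degree v = ⌊ρ⌋₊ ∨ G.degree v = ⌈ρ⌉₊) ∧ 2 * G.edgeFinset.card = ⌈ρ * n⌉₊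

/-- The law of the random graph `G(ρ, n)`: the uniform distribution on the set of all `ρ`-regular
graphs with vertex set `Fin n`. -/
noncomputable def randomRealRegular (ρ : ℝ) (n : ℕ) :
    MeasureTheory.Measure (SimpleGraph (Fin n)) :=
  ProbabilityTheory.uniformOn {G | IsRealRegular ρ G}

/-! Suppose some ordering of G has ordered Ramsey number at most tm. Colour a complete graph with
loops on t vertices at random and blow each vertex up to an interval of at most m vertices. A
monochromatic ordered copy of G yields a monotone map to the t classes with fibres of size at most
m. If all such maps used at least p pairs of classes, a union bound over the at most C(n+t, n)
monotone maps would give a colouring without a copy. Hence G has a sparse quotient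
(`hasSparseQuotient_of_forall_hasOrderedCopy`). This property does not mention the ordering, so no
union over orderings is needed.

At most t^n · C(t², p) · C(pm², e) graphs with e edges have a sparse quotient
(`ncard_hasSparseQuotient_le`), whereas the number of ρ-regular graphs is n^e at least, up to
exponential and polynomial factors (`pow_le_ncard_isRealRegular`). For t ≈ ζn/(2 log(1/ζ)), m ≈ n^ε
and p ≈ ζn, the condition (1/2 − ε)ρ ≥ 1 + ζ balances the powers of n (`sparse_count_le`). What
remains is a polynomial times O(ζ)^n, and this tends to 0 because ζ does. -/

/-! ### Existence of ordered Ramsey numbers. -/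

/-- The finite Ramsey theorem for two colours, relative to a finite vertex set. -/
theorem exists_ramsey_bound (a b : ℕ) : ∃ N : ℕ, ∀ {V : Type} (G : SimpleGraph V) (S : Finset V),
    N ≤ S.card → (∃ T ⊆ S, G.IsNClique a T) ∨ ∃ T ⊆ S, Gᶜ.IsNClique b T := by
  classical
  induction a generalizing b with
  | zero => exact ⟨0, fun G S _ => Or.inl ⟨∅, by simp, by simp⟩⟩
  | succ a iha =>
    induction b with
    | zero => exact ⟨0, fun G S _ => Or.inr ⟨∅, by simp, by simp⟩⟩
    | succ b ihb =>
      obtain ⟨N₁, h₁⟩ := iha (b + 1)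
      obtain ⟨N₂, h₂⟩ := ihb
      refine ⟨N₁ + N₂ + 1, fun {V} G S hS => ?_⟩
      obtain ⟨v, hv⟩ : S.Nonempty := Finset.card_pos.1 (by omega)
      have hcard : ((S.erase v).filter (G.Adj v)).card +
          ((S.erase v).filter fun w => ¬ G.Adj v w).card = S.card - 1 := by
        rw [Finset.card_filter_add_card_filter_not, Finset.card_erase_of_mem hv]
      have hsub : ∀ (q : V → Prop) [DecidablePred q], ∀ T ⊆ (S.erase v).filter q, insert v T ⊆ S := fun q _ T hT =>
        Finset.insert_subset hv fun x hx =>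
          Finset.mem_of_mem_erase (Finset.mem_filter.1 (hT hx)).1
      rcases le_or_gt N₁ ((S.erase v).filter (G.Adj v)).card with h | h
      · rcases h₁ G _ h with ⟨T, hT, hc⟩ | ⟨T, hT, hc⟩
        · exact Or.inl ⟨insert v T, hsub _ T hT,
            hc.insert fun w hw => (Finset.mem_filter.1 (hT hw)).2⟩
        · exact Or.inr ⟨T, (hT.trans (Finset.filter_subset _ _)).trans (Finset.erase_subset _ _), hc⟩
      · rcases h₂ G _ (show N₂ ≤ ((S.erase v).filter fun w => ¬ G.Adj v w).card by omega) with
          ⟨T, hT, hc⟩ | ⟨T, hT, hc⟩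
        · exact Or.inl ⟨T, (hT.trans (Finset.filter_subset _ _)).trans (Finset.erase_subset _ _), hc⟩
        · refine Or.inr ⟨insert v T, hsub _ T hT, hc.insert fun w hw => ?_⟩
          have := Finset.mem_filter.1 (hT hw)
          exact (SimpleGraph.compl_adj _ _ _).2 ⟨(Finset.ne_of_mem_erase this.1).symm, this.2⟩

theorem hasOrderedCopy_of_isNClique {V : Type*} [Fintype V] (ord : LinearOrder V)
    (G : SimpleGraph V) {N : ℕ} (χ : SimpleGraph.TopEdgeLabeling (Fin N) Bool) (k : Bool)
    {T : Finset (Fin N)} (hT : (χ.labelGraph k).IsNClique (Fintype.card V) T) :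
    HasOrderedCopy ord G χ k := by
  let _ := ord
  let e := (Fintype.orderIsoFinOfCardEq V rfl).symm
  let f := T.orderEmbOfFin hT.card_eq
  have hf : StrictMono fun v => f (e v) := fun u v h => f.strictMono (e.strictMono h)
  refine ⟨fun v => f (e v), fun u v h => hf h, fun u v h => ?_⟩
  exact hT.isClique (Finset.orderEmbOfFin_mem _ _ _) (Finset.orderEmbOfFin_mem _ _ _)
    (hf.injective.ne h.ne)

/-- Ramsey's theorem makes the defining set nonempty, so the infimum is attained instead of being
the default value 0. -/
theorem orderedRamsey_spec {V : Type*} [Fintype V] (ord : LinearOrder V) (G : SimpleGraph V) :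
    ∀ χ : SimpleGraph.TopEdgeLabeling (Fin (orderedRamsey ord G)) Bool, ∃ k : Bool,
      HasOrderedCopy ord G χ k := by
  apply Nat.sInf_mem (s := {N : ℕ | ∀ χ : SimpleGraph.TopEdgeLabeling (Fin N) Bool, ∃ k : Bool,
    HasOrderedCopy ord G χ k})
  obtain ⟨N, hN⟩ := exists_ramsey_bound (Fintype.card V) (Fintype.card V)
  refine ⟨N, fun χ => ?_⟩
  rcases hN (χ.labelGraph true) Finset.univ (by simp) with ⟨T, -, hT⟩ | ⟨T, -, hT⟩
  · exact ⟨true, hasOrderedCopy_of_isNClique ord G χ true hT⟩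
  · refine ⟨false, hasOrderedCopy_of_isNClique ord G χ false (hT.mono ?_)⟩
    intro x y hxy
    rw [SimpleGraph.compl_adj] at hxy
    refine (SimpleGraph.TopEdgeLabeling.labelGraph_adj _ _).2 ⟨hxy.1, ?_⟩
    by_contra h
    exact hxy.2 ((SimpleGraph.TopEdgeLabeling.labelGraph_adj _ _).2 ⟨hxy.1, by simpa using h⟩)

theorem exists_orderedRamsey_eq_minOrderedRamsey {V : Type*} [Fintype V] (G : SimpleGraph V) :
    ∃ ord : LinearOrder V, minOrderedRamsey G = orderedRamsey ord G := by
  apply Nat.sInf_mem (s := {r : ℕ | ∃ ord : LinearOrder V, r = orderedRamsey ord G})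
  exact ⟨_, LinearOrder.lift' (Fintype.equivFin V) (Fintype.equivFin V).injective, rfl⟩

theorem card_le_orderedRamsey {V : Type*} [Fintype V] (ord : LinearOrder V) (G : SimpleGraph V) :
    Fintype.card V ≤ orderedRamsey ord G := by
  obtain ⟨k, f, hf, -⟩ := orderedRamsey_spec ord G (fun _ => true)
  let _ := ord
  have hf' : StrictMono f := fun u v h => hf u v h
  simpa using Fintype.card_le_of_injective f hf'.injective

/-- Settles the case where the claimed lower bound is at most n. -/
theorem card_le_minOrderedRamsey {V : Type*} [Fintype V] (G : SimpleGraph V) :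
    Fintype.card V ≤ minOrderedRamsey G := by
  obtain ⟨ord, h⟩ := exists_orderedRamsey_eq_minOrderedRamsey G
  exact h ▸ card_le_orderedRamsey ord G

/-! ### Blow-up colourings and sparse quotients. -/

/-- Monotone maps from `n` points to `t` points are encoded by `n`-subsets of `n + t` points. -/
theorem card_monotone_fin_le (n t : ℕ) :
    (Finset.univ.filter fun g : Fin n → Fin t => Monotone g).card ≤ (n + t).choose n := by
  classical
  let h : (Fin n → Fin t) → Fin n → Fin (n + t) := fun g i => ⟨i + g i, by omega⟩
  have hmono : ∀ g : Fin n → Fin t, Monotone g → StrictMono (h g) := by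
    intro g hg i j hij
    have h1 : (g i : ℕ) ≤ g j := hg hij.le
    have h2 : (i : ℕ) < j := hij
    exact Fin.mk_lt_mk.2 (by omega)
  have hcard : (Finset.powersetCard n (Finset.univ : Finset (Fin (n + t)))).card
      = (n + t).choose n := by simp
  rw [← hcard]
  refine Finset.card_le_card_of_injOn (fun g => Finset.univ.image (h g)) ?_ ?_
  · intro g hg
    have hg' := hmono g (by simpa using hg)
    simp [Finset.mem_powersetCard, Finset.card_image_of_injective _ hg'.injective]
  · intro g hg g' hg' heq
    have h1 := hmono g (by simpa using hg)
    have h2 := hmono g' (by simpa using hg')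
    have h3 : Set.range (h g) = Set.range (h g') := by
      have := congrArg (fun s : Finset (Fin (n + t)) => (s : Set (Fin (n + t)))) heq
      simpa using this
    have h4 := (StrictMono.range_inj h1 h2).1 h3
    funext i
    have h5 := congrArg Fin.val (congrFun h4 i)
    exact Fin.ext (by simpa [h] using h5)

theorem card_monotone_le {V : Type*} [Fintype V] [DecidableEq V] (ord : LinearOrder V) (t : ℕ) :
    ∀ A : Finset (V → Fin t), (∀ g ∈ A, ∀ u v, ord.le u v → g u ≤ g v) →
      A.card ≤ (Fintype.card V + t).choose (Fintype.card V) := by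
  intro A hA
  let _ := ord
  let e := Fintype.orderIsoFinOfCardEq V rfl
  refine le_trans ?_ (card_monotone_fin_le (Fintype.card V) t)
  refine Finset.card_le_card_of_injOn (fun g => g ∘ e) ?_ ?_
  · intro g hg
    exact Finset.mem_filter.2 ⟨Finset.mem_univ _, fun i j hij => hA g hg _ _ (e.monotone hij)⟩
  · intro g _ g' _ h
    exact e.surjective.injective_comp_right h

/-- A random colouring is constantly `k` on `P` with probability 2^(-|P|); denominators are cleared.
-/
theorem card_constant_on_mul_le {E : Type*} [Fintype E] [DecidableEq E] (P : Finset E) (k : Bool) :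
    (Finset.univ.filter fun c : E → Bool => ∀ e ∈ P, c e = k).card * 2 ^ P.card
      ≤ 2 ^ Fintype.card E := by
  have : (Finset.univ.filter fun c : E → Bool => ∀ e ∈ P, c e = k).card ≤
      2 ^ (Fintype.card E - P.card) := by
    have hc : (Finset.univ : Finset ((Pᶜ : Finset E) → Bool)).card
        = 2 ^ (Fintype.card E - P.card) := by
      simp
    rw [← hc]
    refine Finset.card_le_card_of_injOn (fun c e => c e) (fun _ _ => by simp) ?_
    intro c hc c' hc' h
    funext e
    by_cases he : e ∈ P
    · rw [(Finset.mem_filter.1 hc).2 e he, (Finset.mem_filter.1 hc').2 e he]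
    · exact congrFun h ⟨e, Finset.mem_compl.2 he⟩
  calc _ ≤ 2 ^ (Fintype.card E - P.card) * 2 ^ P.card := Nat.mul_le_mul_right _ this
    _ = 2 ^ Fintype.card E := by rw [← pow_add, Nat.sub_add_cancel P.card_le_univ]

/-- `G` admits a map of its vertices to `t` classes with fibres of size at most `m` such that the
edges of `G` lie over fewer than `p` pairs of classes. -/
def HasSparseQuotient {V : Type*} (G : SimpleGraph V) (t m p : ℕ) : Prop :=
  ∃ g : V → Fin t, (∀ i, (g ⁻¹' {i}).ncard ≤ m) ∧
    ∃ P : Finset (Sym2 (Fin t)), P.card < p ∧ ∀ u v, G.Adj u v → s(g u, g v) ∈ P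

/-- If every colouring of a complete graph on at most `t * m` vertices contains a monochromatic
ordered copy of `G`, then this holds for blow-ups of colourings of a complete graph with loops on
`t` vertices, which forces `G` to have a sparse quotient. -/
theorem hasSparseQuotient_of_forall_hasOrderedCopy {V : Type*} [Fintype V] (ord : LinearOrder V)
    (G : SimpleGraph V) {t m p M : ℕ} (hM : M ≤ t * m)
    (hR : ∀ χ : SimpleGraph.TopEdgeLabeling (Fin M) Bool, ∃ k : Bool, HasOrderedCopy ord G χ k)
    (hp : 2 * (Fintype.card V + t).choose (Fintype.card V) < 2 ^ p) :
    HasSparseQuotient G t m p := by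
  classical
  by_contra hG
  -- Consecutive intervals of length `m`; monotonicity of `block` keeps the order of a copy.
  let block : Fin M → Fin t := fun x =>
    ⟨x / m, Nat.div_lt_of_lt_mul (by rw [mul_comm]; exact x.2.trans_le hM)⟩
  have hblock : Monotone block := fun x y h => Nat.div_le_div_right (c := m) h
  have hfib : ∀ i, (block ⁻¹' {i}).ncard ≤ m := by
    intro i
    have hIio : (Set.Iio m).ncard = m := by simp [Set.ncard_eq_toFinset_card']
    conv_rhs => rw [← hIio]
    refine Set.ncard_le_ncard_of_injOn (fun x => (x : ℕ) % m) ?_ ?_ (Set.toFinite _)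
    · intro x _
      refine Nat.mod_lt _ (Nat.pos_of_ne_zero ?_)
      rintro rfl
      have := x.2
      omega
    · intro x hx y hy hxy
      have h1 : (x : ℕ) / m = y / m := congrArg Fin.val (Eq.trans hx hy.symm)
      have h2 : (x : ℕ) % m = y % m := hxy
      exact Fin.ext (by rw [← Nat.div_add_mod x m, ← Nat.div_add_mod y m, h1, h2])
  let P : (V → Fin t) → Finset (Sym2 (Fin t)) := fun g =>
    Finset.univ.filter fun e => ∃ u v, G.Adj u v ∧ e = s(g u, g v)
  let A : Finset (V → Fin t) := Finset.univ.filter fun g =>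
    (∀ u v, ord.le u v → g u ≤ g v) ∧ ∀ i, (g ⁻¹' {i}).ncard ≤ m
  have hP : ∀ g ∈ A, p ≤ (P g).card := by
    intro g hg
    by_contra! hlt
    refine hG ⟨g, (Finset.mem_filter.1 hg).2.2, P g, hlt, fun u v h => ?_⟩
    exact Finset.mem_filter.2 ⟨Finset.mem_univ _, u, v, h, rfl⟩
  have hcover : ∀ c : Sym2 (Fin t) → Bool, ∃ k, ∃ g ∈ A, ∀ e ∈ P g, c e = k := by
    intro c
    -- A pair inside one block receives the colour of the loop at that block.
    obtain ⟨k, f, hf, hadj⟩ := hR fun e => c (Sym2.map block e)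
    have hfinj : Function.Injective f := by
      let _ := ord
      exact StrictMono.injective (f := f) fun u v h => hf u v h
    have hfmono : ∀ u v, ord.le u v → f u ≤ f v := by
      let _ := ord
      exact fun u v h => StrictMono.monotone (f := f) (fun u v h => hf u v h) h
    refine ⟨k, fun v => block (f v), ?_, ?_⟩
    · refine Finset.mem_filter.2 ⟨Finset.mem_univ _, fun u v h => hblock (hfmono u v h), fun i => ?_⟩
      refine le_trans ?_ (hfib i)
      exact Set.ncard_le_ncard_of_injOn f (fun v hv => hv) hfinj.injOn (Set.toFinite _)
    · intro e he
      obtain ⟨u, v, huv, rfl⟩ := (Finset.mem_filter.1 he).2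
      obtain ⟨h1, h2⟩ := (SimpleGraph.EdgeLabeling.labelGraph_adj _ _).1 (hadj u v huv)
      simpa using h2
  have hA : A.card ≤ (Fintype.card V + t).choose (Fintype.card V) :=
    card_monotone_le ord t A fun g hg => (Finset.mem_filter.1 hg).2.1
  have hun : (Finset.univ : Finset (Sym2 (Fin t) → Bool)) ⊆
      (Finset.univ ×ˢ A).biUnion fun kg : Bool × (V → Fin t) =>
        Finset.univ.filter fun c => ∀ e ∈ P kg.2, c e = kg.1 := by
    intro c _
    obtain ⟨k, g, hg, hc⟩ := hcover c
    exact Finset.mem_biUnion.2 ⟨(k, g), by simp [hg], by simpa using hc⟩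
  -- Union bound: `2 * A.card` events, each of probability at most 2^(-p), cover all colourings.
  have h1 := (Finset.card_le_card hun).trans Finset.card_biUnion_le
  have h2 : 2 ^ Fintype.card (Sym2 (Fin t)) * 2 ^ p ≤
      (2 * A.card) * 2 ^ Fintype.card (Sym2 (Fin t)) := by
    calc _ = (Finset.univ : Finset (Sym2 (Fin t) → Bool)).card * 2 ^ p := by simp
      _ ≤ _ := Nat.mul_le_mul_right _ h1
      _ = ∑ kg ∈ Finset.univ ×ˢ A, (Finset.univ.filter fun c : Sym2 (Fin t) → Bool =>
            ∀ e ∈ P kg.2, c e = kg.1).card * 2 ^ p := by rw [Finset.sum_mul]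
      _ ≤ ∑ kg ∈ (Finset.univ : Finset Bool) ×ˢ A, 2 ^ Fintype.card (Sym2 (Fin t)) := by
          refine Finset.sum_le_sum fun kg hkg => ?_
          refine le_trans ?_ (card_constant_on_mul_le (P kg.2) kg.1)
          exact Nat.mul_le_mul_left _
            (Nat.pow_le_pow_right (by norm_num) (hP _ (Finset.mem_product.1 hkg).2))
      _ = _ := by simp
  have h3 : 2 ^ p ≤ 2 * A.card := by
    rw [mul_comm] at h2
    exact Nat.le_of_mul_le_mul_right h2 (by positivity)
  omega

/-! ### Counting graphs with a sparse quotient. -/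

theorem card_sym2_map_fiber_le {V W : Type*} [Fintype V] [DecidableEq V] [DecidableEq W]
    (g : V → W) {m : ℕ} (hg : ∀ i, (g ⁻¹' {i}).ncard ≤ m) (e : Sym2 W) :
    (Finset.univ.filter fun x : Sym2 V => Sym2.map g x = e).card ≤ m ^ 2 := by
  induction e using Sym2.inductionOn with
  | hf i j =>
    have hcard : ∀ i, (Finset.univ.filter fun v => g v = i).card ≤ m := fun i => by
      rw [← Set.ncard_coe_finset]
      convert hg i using 2
      ext v
      simp
    have hsub : (Finset.univ.filter fun x : Sym2 V => Sym2.map g x = s(i, j)) ⊆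
        ((Finset.univ.filter fun v => g v = i) ×ˢ (Finset.univ.filter fun v => g v = j)).image
          fun uv => s(uv.1, uv.2) := by
      intro x hx
      induction x using Sym2.inductionOn with
      | hf u v =>
        have := (Finset.mem_filter.1 hx).2
        rw [Sym2.map_mk, Sym2.eq_iff] at this
        rcases this with ⟨h1, h2⟩ | ⟨h1, h2⟩
        · exact Finset.mem_image.2 ⟨(u, v), by simp [h1, h2], rfl⟩
        · exact Finset.mem_image.2 ⟨(v, u), by simp [h1, h2], Sym2.eq_swap⟩
    calc _ ≤ _ := Finset.card_le_card hsub
      _ ≤ _ := Finset.card_image_le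
      _ ≤ m ^ 2 := by
        rw [Finset.card_product, sq]
        exact Nat.mul_le_mul (hcard i) (hcard j)

theorem ncard_edgeSet {V : Type*} (G : SimpleGraph V) [Fintype G.edgeSet] :
    G.edgeSet.ncard = G.edgeFinset.card := by
  rw [SimpleGraph.edgeFinset, Set.ncard_eq_toFinset_card']

/-- The number of graphs with `e` edges that have a sparse quotient. -/
theorem ncard_hasSparseQuotient_le {V : Type*} [Fintype V] {t m p e : ℕ}
    (hp : p ≤ Fintype.card (Sym2 (Fin t))) :
    {G : SimpleGraph V | G.edgeSet.ncard = e ∧ HasSparseQuotient G t m p}.ncard ≤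
      t ^ Fintype.card V * (Fintype.card (Sym2 (Fin t))).choose p * (p * m ^ 2).choose e := by
  classical
  let I : Finset ((V → Fin t) × Finset (Sym2 (Fin t))) :=
    (Finset.univ.filter fun g : V → Fin t => ∀ i, (g ⁻¹' {i}).ncard ≤ m) ×ˢ
      Finset.powersetCard p Finset.univ
  let E : (V → Fin t) × Finset (Sym2 (Fin t)) → Finset (Sym2 V) := fun gP =>
    Finset.univ.filter fun x => Sym2.map gP.1 x ∈ gP.2
  have hE : ∀ gP ∈ I, (E gP).card ≤ p * m ^ 2 := by
    intro gP h
    obtain ⟨h1, h2⟩ := Finset.mem_product.1 h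
    have hg := (Finset.mem_filter.1 h1).2
    have hP := (Finset.mem_powersetCard.1 h2).2
    have hsub : E gP ⊆ gP.2.biUnion fun e => Finset.univ.filter fun x => Sym2.map gP.1 x = e := by
      intro x hx
      exact Finset.mem_biUnion.2 ⟨_, (Finset.mem_filter.1 hx).2, by simp⟩
    rw [← hP]
    refine (Finset.card_le_card hsub).trans ?_
    exact Finset.card_biUnion_le_card_mul _ _ _ fun e _ => card_sym2_map_fiber_le gP.1 hg e
  have hcover : ∀ G ∈ {G : SimpleGraph V | G.edgeSet.ncard = e ∧ HasSparseQuotient G t m p},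
      G.edgeFinset ∈ (I.biUnion fun gP => Finset.powersetCard e (E gP) : Set (Finset (Sym2 V))) := by
    rintro G ⟨he, g, hg, P, hP, hadj⟩
    rw [ncard_edgeSet] at he
    -- Padding `P` to exactly `p` pairs lets a single binomial coefficient count the choices.
    obtain ⟨Q, hPQ, hQ⟩ := Finset.exists_superset_card_eq hP.le hp
    refine Finset.mem_biUnion.2 ⟨(g, Q), ?_, ?_⟩
    · exact Finset.mem_product.2 ⟨by simpa using hg, Finset.mem_powersetCard.2 ⟨by simp, hQ⟩⟩
    · refine Finset.mem_powersetCard.2 ⟨fun x hx => ?_, he⟩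
      induction x using Sym2.inductionOn with
      | hf u v =>
        rw [SimpleGraph.mem_edgeFinset, SimpleGraph.mem_edgeSet] at hx
        exact Finset.mem_filter.2 ⟨Finset.mem_univ _, hPQ (hadj u v hx)⟩
  have hinj : Function.Injective fun G : SimpleGraph V => G.edgeFinset := fun G H h =>
    SimpleGraph.edgeFinset_inj.1 h
  refine (Set.ncard_le_ncard_of_injOn _ hcover hinj.injOn (Finset.finite_toSet _)).trans ?_
  rw [Set.ncard_coe_finset]
  refine (Finset.card_biUnion_le_card_mul _ _ ((p * m ^ 2).choose e) fun gP h => ?_).trans ?_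
  · rw [Finset.card_powersetCard]
    exact Nat.choose_le_choose e (hE gP h)
  · refine Nat.mul_le_mul_right _ ?_
    rw [Finset.card_product, Finset.card_powersetCard, Finset.card_univ]
    refine Nat.mul_le_mul_right _ ((Finset.card_filter_le _ _).trans ?_)
    simp

/-! ### Graphs with nearly equal degrees. -/

/-- Moving the end of one edge from `u` to `v`. -/
theorem sum_sq_degree_move_lt {W : Type*} [Fintype W] [DecidableEq W] (F : Finset (Sym2 W))
    {u v w : W} (huw : s(u, w) ∈ F) (hvw : s(v, w) ∉ F) (hwu : w ≠ u) (hwv : w ≠ v)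
    (h : (F.filter (v ∈ ·)).card + 2 ≤ (F.filter (u ∈ ·)).card) :
    ∑ x, ((insert s(v, w) (F.erase s(u, w))).filter (x ∈ ·)).card ^ 2 <
      ∑ x, (F.filter (x ∈ ·)).card ^ 2 := by
  have huv : u ≠ v := by
    rintro rfl
    omega
  have hval : ∀ x, (((insert s(v, w) (F.erase s(u, w))).filter (x ∈ ·)).card : ℤ) =
      (F.filter (x ∈ ·)).card - (if x = u then 1 else 0) + (if x = v then 1 else 0) := by
    intro x
    simp only [Finset.card_filter, Nat.cast_sum]
    rw [Finset.sum_insert (fun h => hvw (Finset.mem_of_mem_erase h)),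
      ← Finset.add_sum_erase F _ huw]
    simp only [Sym2.mem_iff]
    by_cases h1 : x = u <;> by_cases h2 : x = v <;> by_cases h3 : x = w <;>
      simp_all [add_comm]
  zify
  have key : ∀ x, (((insert s(v, w) (F.erase s(u, w))).filter (x ∈ ·)).card : ℤ) ^ 2 =
      ((F.filter (x ∈ ·)).card : ℤ) ^ 2 +
        (if x = u then (-2 * ((F.filter (x ∈ ·)).card : ℤ) + 1) else 0) +
        (if x = v then (2 * ((F.filter (x ∈ ·)).card : ℤ) + 1) else 0) := by
    intro x
    rw [hval]
    by_cases h1 : x = u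
    · have h2 : x ≠ v := fun h => huv (h1 ▸ h)
      simp only [h1, if_true, if_neg huv]
      ring
    · by_cases h2 : x = v
      · simp only [h2, if_true, if_neg huv.symm]
        ring
      · simp [h1, h2]
  -- The sum of squares changes by 2(deg v − deg u + 1), which is at most −2.
  rw [Finset.sum_congr rfl fun x _ => key x, Finset.sum_add_distrib, Finset.sum_add_distrib]
  simp only [Finset.sum_ite_eq', Finset.mem_univ, if_true]
  zify at h
  linarith

open Classical in
/-- There are graphs with any prescribed number of edges in which all degrees differ by at most
one. -/
theorem exists_balanced_graph {W : Type*} [Fintype W] {m : ℕ}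
    (hm : m ≤ (Fintype.card W).choose 2) :
    ∃ B : SimpleGraph W, B.edgeFinset.card = m ∧ ∀ u v, B.degree u ≤ B.degree v + 1 := by
  let Φ : Finset (Sym2 W) → ℕ := fun F => ∑ x, (F.filter (x ∈ ·)).card ^ 2
  have hne : (Finset.powersetCard m (⊤ : SimpleGraph W).edgeFinset).Nonempty := by
    rw [Finset.powersetCard_nonempty, SimpleGraph.card_edgeFinset_top_eq_card_choose_two]
    exact hm
  -- A minimiser of the sum of squared degrees is balanced: a degree gap of two would allow an edge
  -- to be moved, lowering the sum.
  obtain ⟨F, hF, hmin⟩ := Finset.exists_min_image _ Φ hne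
  obtain ⟨hsub, hcard⟩ := Finset.mem_powersetCard.1 hF
  have hdiag : ∀ e ∈ F, ¬ e.IsDiag := fun e he => by
    have := hsub he
    rw [SimpleGraph.mem_edgeFinset] at this
    exact SimpleGraph.not_isDiag_of_mem_edgeSet _ this
  obtain ⟨B, hB'⟩ : ∃ B : SimpleGraph W, B.edgeSet = F := by
    refine ⟨SimpleGraph.fromEdgeSet F, ?_⟩
    ext e
    rw [SimpleGraph.edgeSet_fromEdgeSet]
    exact ⟨fun h => h.1, fun h => ⟨h, hdiag e h⟩⟩
  have hB : B.edgeFinset = F := by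
    rw [← Finset.coe_inj, SimpleGraph.coe_edgeFinset, hB']
  have hadj : ∀ x y, B.Adj x y ↔ s(x, y) ∈ F := fun x y => by
    rw [← hB, SimpleGraph.mem_edgeFinset, SimpleGraph.mem_edgeSet]
  have hdeg : ∀ v, B.degree v = (F.filter (v ∈ ·)).card := by
    intro v
    rw [← SimpleGraph.card_incidenceFinset_eq_degree, SimpleGraph.incidenceFinset_eq_filter, hB]
  refine ⟨B, by rw [hB, hcard], fun u v => ?_⟩
  by_contra! hlt
  -- The new edge must not be a loop, so `v` is discarded from the neighbours of `u`; a gap of two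
  -- survives this.
  have hlt' : (B.neighborFinset v).card < ((B.neighborFinset u).erase v).card := by
    have := Finset.pred_card_le_card_erase (s := B.neighborFinset u) (a := v)
    rw [SimpleGraph.card_neighborFinset_eq_degree] at this ⊢
    omega
  obtain ⟨w, hw, hw'⟩ := Finset.exists_mem_notMem_of_card_lt_card hlt'
  rw [Finset.mem_erase, SimpleGraph.mem_neighborFinset] at hw
  rw [SimpleGraph.mem_neighborFinset, hadj] at hw'
  obtain ⟨hwv, huw'⟩ := hw
  have huw := (hadj u w).1 huw'
  have hne' := huw'.ne
  have hvw : s(v, w) ∉ F := hw'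
  rw [hdeg, hdeg] at hlt
  have hlt2 := sum_sq_degree_move_lt F huw hvw hne'.symm hwv (by omega)
  refine absurd (hmin (insert s(v, w) (F.erase s(u, w))) ?_) (not_le.2 hlt2)
  refine Finset.mem_powersetCard.2 ⟨Finset.insert_subset ?_
    ((Finset.erase_subset _ _).trans hsub), ?_⟩
  · simpa using hwv.symm
  · rw [Finset.card_insert_of_notMem (fun h => hvw (Finset.mem_of_mem_erase h)),
      Finset.card_erase_of_mem huw, hcard]
    have := Finset.card_pos.2 ⟨_, huw⟩
    omega

-- The average degree lies in [d, d + 1] and degrees differ by at most one, so none falls outside.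
open Classical in
theorem exists_near_regular_graph {W : Type*} [Fintype W] {d m : ℕ}
    (hm : m ≤ (Fintype.card W).choose 2) (h₁ : d * Fintype.card W ≤ 2 * m)
    (h₂ : 2 * m ≤ (d + 1) * Fintype.card W) :
    ∃ B : SimpleGraph W, B.edgeFinset.card = m ∧ ∀ v, B.degree v = d ∨ B.degree v = d + 1 := by
  obtain ⟨B, hB, hbal⟩ := exists_balanced_graph hm
  refine ⟨B, hB, fun v => ?_⟩
  have hsum := B.sum_degrees_eq_twice_card_edges
  rw [hB] at hsum
  have hlow : d ≤ B.degree v := by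
    by_contra! hlt
    have : ∑ u, B.degree u < ∑ _u : W, d := Finset.sum_lt_sum
      (fun u _ => by have := hbal u v; omega) ⟨v, Finset.mem_univ _, hlt⟩
    simp at this
    rw [mul_comm] at this
    omega
  have hhigh : B.degree v ≤ d + 1 := by
    by_contra! hlt
    have : ∑ _u : W, (d + 1) < ∑ u, B.degree u := Finset.sum_lt_sum
      (fun u _ => by have := hbal v u; omega) ⟨v, Finset.mem_univ _, hlt⟩
    simp only [Finset.sum_const, Finset.card_univ, smul_eq_mul] at this
    rw [mul_comm] at this
    omega
  omega

/-! ### Near-regular graphs from blow-ups by matchings. -/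

/-- All degrees of `G` are `d` or `d + 1`, and `G` has `e` edges. -/
def IsNearRegular {V : Type*} (d e : ℕ) (G : SimpleGraph V) : Prop :=
  (∀ v, (G.neighborSet v).ncard = d ∨ (G.neighborSet v).ncard = d + 1) ∧ G.edgeSet.ncard = e

theorem ncard_neighborSet {V : Type*} (G : SimpleGraph V) (v : V) [Fintype (G.neighborSet v)] :
    (G.neighborSet v).ncard = G.degree v := by
  rw [← SimpleGraph.card_neighborSet_eq_degree, Set.ncard_eq_toFinset_card', Set.toFinset_card]

theorem sum_ncard_neighborSet {V : Type*} [Fintype V] (G : SimpleGraph V) :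
    ∑ v, (G.neighborSet v).ncard = 2 * G.edgeSet.ncard := by
  classical
  simp_rw [ncard_neighborSet, ncard_edgeSet]
  exact G.sum_degrees_eq_twice_card_edges

theorem IsNearRegular.of_iso {V W : Type*} {G : SimpleGraph V} {H : SimpleGraph W} {d e : ℕ}
    (f : G ≃g H) (h : IsNearRegular d e H) : IsNearRegular d e G := by
  refine ⟨fun v => ?_, ?_⟩
  · have := Nat.card_congr (f.mapNeighborSet v)
    rw [Nat.card_coe_set_eq, Nat.card_coe_set_eq] at this
    rw [this]
    exact h.1 (f v)
  · have := Nat.card_congr f.mapEdgeSet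
    rw [Nat.card_coe_set_eq, Nat.card_coe_set_eq] at this
    rw [this, h.2]

theorem ncard_isNearRegular_le_of_equiv {V W : Type*} [Finite W] (f : V ≃ W) (d e : ℕ) :
    {G : SimpleGraph V | IsNearRegular d e G}.ncard ≤
      {G : SimpleGraph W | IsNearRegular d e G}.ncard := by
  refine Set.ncard_le_ncard_of_injOn (fun G => G.comap f.symm)
    (fun G hG => IsNearRegular.of_iso (SimpleGraph.Iso.comap f.symm G) hG) ?_ (Set.toFinite _)
  intro G _ H _ h
  ext u v
  have := congrArg (fun K : SimpleGraph W => K.Adj (f u) (f v)) h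
  simpa using this

theorem ncard_neighborSet_sum_inl {V W : Type*} (G : SimpleGraph V) (H : SimpleGraph W) (v : V) :
    ((G ⊕g H).neighborSet (Sum.inl v)).ncard = (G.neighborSet v).ncard := by
  rw [← Set.ncard_image_of_injective (G.neighborSet v) Sum.inl_injective]
  congr 1
  ext (x | x) <;> simp

theorem ncard_neighborSet_sum_inr {V W : Type*} (G : SimpleGraph V) (H : SimpleGraph W) (w : W) :
    ((G ⊕g H).neighborSet (Sum.inr w)).ncard = (H.neighborSet w).ncard := by
  rw [← Set.ncard_image_of_injective (H.neighborSet w) Sum.inr_injective]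
  congr 1
  ext (x | x) <;> simp

/-- The bipartite graph of a relation. -/
def graphOfRel {α β : Type*} (r : α → β → Prop) : SimpleGraph (α ⊕ β) where
  Adj
    | Sum.inl a, Sum.inr b => r a b
    | Sum.inr b, Sum.inl a => r a b
    | _, _ => False
  symm := ⟨by rintro (a | a) (b | b) h <;> exact h⟩
  loopless := ⟨by rintro (a | a) h <;> exact h⟩

theorem ncard_neighborSet_graphOfRel_inl {α β : Type*} (r : α → β → Prop) (a : α) :
    ((graphOfRel r).neighborSet (Sum.inl a)).ncard = {b | r a b}.ncard := by
  rw [← Set.ncard_image_of_injective {b | r a b} Sum.inr_injective]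
  congr 1
  ext (x | x) <;> simp [graphOfRel]

theorem ncard_neighborSet_graphOfRel_inr {α β : Type*} (r : α → β → Prop) (b : β) :
    ((graphOfRel r).neighborSet (Sum.inr b)).ncard = {a | r a b}.ncard := by
  rw [← Set.ncard_image_of_injective {a | r a b} Sum.inl_injective]
  congr 1
  ext (x | x) <;> simp [graphOfRel]

section BlowUp

variable {A X : Type*}

/-- A blow-up of a complete bipartite graph in which each edge `(a, b)` is replaced by the matching
given by the permutation `π a b`; of the matchings with `a = b` only the edges at `S` are kept. -/
def matchingBlowUp (π : A → A → Equiv.Perm X) (S : Set (A × X)) :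
    SimpleGraph ((A × X) ⊕ (A × X)) :=
  graphOfRel fun ax bY => π ax.1 bY.1 ax.2 = bY.2 ∧ (ax.1 = bY.1 → ax ∈ S)

/-- Counts the classes in which a vertex of the blow-up has a neighbour: all but its own, and its
own exactly if `P` holds. -/
theorem ncard_setOf_imp [Fintype A] (a : A) (P : Prop) [Decidable P] :
    {b : A | a = b → P}.ncard + 1 = Fintype.card A + if P then 1 else 0 := by
  classical
  by_cases h : P
  · simp [h, Set.ncard_univ]
  · have : {b : A | a = b → P} = {a}ᶜ := by
      ext b
      simp [h, eq_comm]
    rw [this, Set.ncard_compl, Set.ncard_singleton]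
    have : 0 < Fintype.card A := Fintype.card_pos_iff.2 ⟨a⟩
    simp [h]
    omega

/-- The only neighbour of `(a, x)` in class `b` is `(b, π a b x)`, so only diagonal values outside
`S` are lost. -/
theorem matchingBlowUp_determines {π π' : A → A → Equiv.Perm X} {S : Set (A × X)}
    (h : matchingBlowUp π S = matchingBlowUp π' S) {a b : A} {x : X} (hx : a = b → (a, x) ∈ S) :
    π a b x = π' a b x := by
  have : (matchingBlowUp π S).Adj (Sum.inl (a, x)) (Sum.inr (b, π a b x)) := ⟨rfl, hx⟩
  rw [h] at this
  exact this.1.symm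

variable [Fintype A] (π : A → A → Equiv.Perm X) (S : Set (A × X))

open Classical in
theorem ncard_neighborSet_matchingBlowUp_inl (ax : A × X) :
    ((matchingBlowUp π S).neighborSet (Sum.inl ax)).ncard + 1 =
      Fintype.card A + if ax ∈ S then 1 else 0 := by
  rw [matchingBlowUp, ncard_neighborSet_graphOfRel_inl, ← ncard_setOf_imp ax.1,
    ← Set.ncard_image_of_injective (f := fun b => (b, π ax.1 b ax.2)) _
      (fun b c h => (Prod.ext_iff.1 h).1)]
  congr 2
  ext ⟨b, y⟩
  simp
  grind

open Classical in
theorem ncard_neighborSet_matchingBlowUp_inr (ax : A × X) :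
    ((matchingBlowUp π S).neighborSet (Sum.inr ax)).ncard + 1 =
      Fintype.card A + if (ax.1, (π ax.1 ax.1).symm ax.2) ∈ S then 1 else 0 := by
  rw [matchingBlowUp, ncard_neighborSet_graphOfRel_inr, ← ncard_setOf_imp ax.1,
    ← Set.ncard_image_of_injective (f := fun b => (b, (π b ax.1).symm ax.2)) _
      (fun b c h => (Prod.ext_iff.1 h).1)]
  congr 2
  ext ⟨b, y⟩
  simp [Equiv.symm_apply_eq]
  grind

theorem ncard_edgeSet_matchingBlowUp [Fintype X] :
    (matchingBlowUp π S).edgeSet.ncard + Fintype.card A * Fintype.card X =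
      Fintype.card A * Fintype.card X * Fintype.card A + S.ncard := by
  classical
  have h := sum_ncard_neighborSet (matchingBlowUp π S)
  rw [Fintype.sum_sum_type] at h
  have hS : ∑ ax : A × X, (if ax ∈ S then 1 else 0) = S.ncard := by
    rw [Finset.sum_boole, Set.ncard_eq_toFinset_card']
    simp [Set.toFinset]
  have hl : ∑ ax, (((matchingBlowUp π S).neighborSet (Sum.inl ax)).ncard + 1) =
      Fintype.card A * Fintype.card X * Fintype.card A + S.ncard := by
    simp_rw [ncard_neighborSet_matchingBlowUp_inl, Finset.sum_add_distrib, hS]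
    simp
  have hr : ∑ ax, (((matchingBlowUp π S).neighborSet (Sum.inr ax)).ncard + 1) =
      Fintype.card A * Fintype.card X * Fintype.card A + S.ncard := by
    simp_rw [ncard_neighborSet_matchingBlowUp_inr, Finset.sum_add_distrib]
    -- The diagonal permutations match the right ends of the kept diagonal edges with `S`.
    have : ∑ ax : A × X, (if (ax.1, (π ax.1 ax.1).symm ax.2) ∈ S then 1 else 0) =
        ∑ ax : A × X, (if ax ∈ S then 1 else 0) :=
      Equiv.sum_comp (Equiv.prodShear (Equiv.refl A) fun a => (π a a).symm)
        fun ax => if ax ∈ S then 1 else 0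
    rw [this, hS]
    simp
  rw [Finset.sum_add_distrib] at hl hr
  simp at hl hr
  omega

end BlowUp

/-- The k² permutations can be recovered from the blow-up and the k·q − s diagonal values outside
`S`. The graph `B` fills up the leftover vertices. -/
theorem factorial_pow_le_mul_ncard_isNearRegular {k q r s m : ℕ} (hk : 0 < k) (hs : s ≤ k * q)
    (B : SimpleGraph (Fin r)) (hB : IsNearRegular (k - 1) m B) :
    (q.factorial) ^ (k * k) ≤
      {G : SimpleGraph (((Fin k × Fin q) ⊕ (Fin k × Fin q)) ⊕ Fin r) |
        IsNearRegular (k - 1) (k * q * (k - 1) + s + m) G}.ncard * q ^ (k * q - s) := by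
  classical
  obtain ⟨S, -, hS⟩ := Finset.exists_subset_card_eq
    (show s ≤ (Finset.univ : Finset (Fin k × Fin q)).card by simpa using hs)
  have hreg : ∀ π : Fin k → Fin k → Equiv.Perm (Fin q),
      IsNearRegular (k - 1) (k * q * (k - 1) + s + m) (matchingBlowUp π (S : Set _) ⊕g B) := by
    intro π
    constructor
    · rintro ((v | v) | v)
      · have := ncard_neighborSet_matchingBlowUp_inl π (S : Set _) v
        rw [ncard_neighborSet_sum_inl]
        simp only [Fintype.card_fin] at this
        split_ifs at this <;> omega
      · have := ncard_neighborSet_matchingBlowUp_inr π (S : Set _) v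
        rw [ncard_neighborSet_sum_inl]
        simp only [Fintype.card_fin] at this
        split_ifs at this <;> omega
      · rw [ncard_neighborSet_sum_inr]
        exact hB.1 v
    · have h1 := sum_ncard_neighborSet (matchingBlowUp π (S : Set _) ⊕g B)
      rw [Fintype.sum_sum_type] at h1
      simp_rw [ncard_neighborSet_sum_inl, ncard_neighborSet_sum_inr, sum_ncard_neighborSet] at h1
      have h2 := ncard_edgeSet_matchingBlowUp π (S : Set _)
      rw [hB.2] at h1
      simp only [Fintype.card_fin, Set.ncard_coe_finset, hS] at h2
      obtain ⟨j, rfl⟩ := Nat.exists_eq_add_of_le' hk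
      simp only [Nat.add_sub_cancel]
      nlinarith
  let T := {G : SimpleGraph (((Fin k × Fin q) ⊕ (Fin k × Fin q)) ⊕ Fin r) |
        IsNearRegular (k - 1) (k * q * (k - 1) + s + m) G}
  let Φ : (Fin k → Fin k → Equiv.Perm (Fin q)) → T × ((Sᶜ : Finset (Fin k × Fin q)) → Fin q) :=
    fun π => (⟨_, hreg π⟩, fun ax => π ax.1.1 ax.1.1 ax.1.2)
  have hΦ : Function.Injective Φ := by
    intro π π' h
    obtain ⟨h1, h2⟩ := Prod.ext_iff.1 h
    have h3 : matchingBlowUp π (S : Set _) = matchingBlowUp π' (S : Set _) := by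
      have h4 : (matchingBlowUp π (S : Set _) ⊕g B) = (matchingBlowUp π' (S : Set _) ⊕g B) :=
        congrArg Subtype.val h1
      ext u v
      rw [← SimpleGraph.sum_adj_inl (H := B), h4, SimpleGraph.sum_adj_inl]
    funext a b
    ext x : 1
    by_cases hx : a = b → (a, x) ∈ S
    · exact matchingBlowUp_determines h3 hx
    · push Not at hx
      obtain ⟨rfl, hx⟩ := hx
      exact congrFun h2 ⟨(a, x), by simpa using hx⟩
  have := Fintype.card_le_of_injective Φ hΦ
  simp only [Fintype.card_pi, Finset.prod_const, Fintype.card_perm, Fintype.card_fin,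
    Finset.card_univ, Fintype.card_prod, Fintype.card_coe, Finset.card_compl, hS] at this
  rw [← pow_mul, ← Nat.card_eq_fintype_card (α := T), Nat.card_coe_set_eq] at this
  exact this

/-! ### Lower bound for the number of regular graphs. -/

theorem self_pow_le_factorial_mul (q : ℕ) : q ^ q ≤ q.factorial * 3 ^ q := by
  have h1 := Real.pow_div_factorial_le_exp (x := (q : ℝ)) (by positivity) q
  have h2 : Real.exp q ≤ 3 ^ q := by
    rw [← Real.exp_one_pow]
    exact pow_le_pow_left₀ (Real.exp_pos 1).le Real.exp_one_lt_three.le q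
  rw [div_le_iff₀ (by positivity)] at h1
  have h3 : ((q : ℝ)) ^ q ≤ q.factorial * 3 ^ q := by
    rw [mul_comm]
    exact h1.trans (mul_le_mul_of_nonneg_right h2 (by positivity))
  exact_mod_cast h3

/-- The bound C(a, b) ≤ (ea/b)^b with 3 for e, free of division. -/
theorem choose_mul_self_pow_le (a b : ℕ) : a.choose b * b ^ b ≤ (3 * a) ^ b := by
  calc a.choose b * b ^ b ≤ a.choose b * (b.factorial * 3 ^ b) :=
        Nat.mul_le_mul_left _ (self_pow_le_factorial_mul b)
    _ = (b.factorial * a.choose b) * 3 ^ b := by ring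
    _ ≤ a ^ b * 3 ^ b := by
        rw [← Nat.descFactorial_eq_factorial_mul_choose]
        exact Nat.mul_le_mul_right _ (Nat.descFactorial_le_pow a b)
    _ = (3 * a) ^ b := by rw [mul_pow, mul_comm]

/-- A lower bound, sharp up to exponential factors, for the number of graphs with `e` edges whose
degrees are all `k - 1` or `k`. -/
theorem pow_le_ncard_isNearRegular {k n e h : ℕ} (hk : 0 < k) (hn : 6 * k + 2 ≤ n) (hh : h ≤ n)
    (he : 2 * e = (k - 1) * n + h) :
    n ^ e ≤ {G : SimpleGraph (Fin n) | IsNearRegular (k - 1) e G}.ncard *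
      (12 * k) ^ (k * n) * n ^ (k * (3 * k + 1)) := by
  classical
  obtain ⟨d, rfl⟩ := Nat.exists_eq_add_of_le' hk
  simp only [Nat.add_sub_cancel] at he ⊢
  set k := d + 1 with hkd
  -- The remainder r = n − 2kq lies in [k + 1, 3k]: large enough to carry degrees up to k, small
  -- enough that its edges cost only a polynomial factor.
  obtain ⟨q, hq1, hq2⟩ : ∃ q, 2 * k * q + (k + 1) ≤ n ∧ n < 2 * k * q + (3 * k + 1) := by
    refine ⟨(n - (k + 1)) / (2 * k), ?_, ?_⟩
    · have := Nat.mul_div_le (n - (k + 1)) (2 * k)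
      omega
    · have := Nat.lt_mul_div_succ (n - (k + 1)) (show 0 < 2 * k by omega)
      rw [mul_add] at this
      omega
  obtain ⟨r, hr⟩ := Nat.exists_eq_add_of_le (show 2 * k * q ≤ n by omega)
  have hq4 : n ≤ 4 * k * q := by
    have : 4 * k * q = 2 * (2 * k * q) := by ring
    omega
  have hq : 0 < q := by
    rcases Nat.eq_zero_or_pos q with rfl | h
    · simp at hq4
      omega
    · exact h
  -- Each kept diagonal edge absorbs two units of the degree surplus `h`; the remaining h − 2s must
  -- fit on the `r` leftover vertices.
  obtain ⟨s, hs, hs2, hsr⟩ : ∃ s, s ≤ k * q ∧ 2 * s ≤ h ∧ h ≤ 2 * s + r := by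
    have : 2 * k * q = 2 * (k * q) := by ring
    rcases le_total (h / 2) (k * q) with h1 | h1
    · exact ⟨h / 2, h1, by omega, by omega⟩
    · exact ⟨k * q, le_rfl, by omega, by omega⟩
  have he' : 2 * e = 2 * (k * q * d) + d * r + h := by
    rw [he, hr]
    ring
  obtain ⟨m, hm⟩ := Nat.exists_eq_add_of_le
    (show k * q * d + s ≤ e by have := Nat.zero_le (d * r); omega)
  have hm2 : 2 * m + 2 * s = d * r + h := by omega
  have hkr : k * r = d * r + r := by rw [hkd]; ring
  have hmr : m ≤ (Fintype.card (Fin r)).choose 2 := by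
    rw [Fintype.card_fin, Nat.choose_two_right, Nat.le_div_iff_mul_le (by norm_num)]
    have : r * k ≤ r * (r - 1) := Nat.mul_le_mul_left _ (by omega)
    rw [mul_comm r k] at this
    omega
  obtain ⟨B, hB, hBdeg⟩ := exists_near_regular_graph (W := Fin r) (d := d) hmr
    (by rw [Fintype.card_fin]; omega) (by rw [Fintype.card_fin, ← hkd]; omega)
  have hBreg : IsNearRegular (k - 1) m B :=
    ⟨fun v => by rw [ncard_neighborSet]; exact hBdeg v, by rw [ncard_edgeSet, hB]⟩
  have hcount := factorial_pow_le_mul_ncard_isNearRegular hk hs B hBreg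
  have hcard : Fintype.card (((Fin k × Fin q) ⊕ (Fin k × Fin q)) ⊕ Fin r) = n := by
    simp only [Fintype.card_sum, Fintype.card_prod, Fintype.card_fin]
    rw [hr]
    ring
  have htrans := ncard_isNearRegular_le_of_equiv (Fintype.equivFinOfCardEq hcard) d e
  have hk1 : k - 1 = d := rfl
  rw [hk1, ← hm] at hcount
  set c := {G : SimpleGraph (Fin n) | IsNearRegular d e G}.ncard with hc
  -- Of q^(k²q), the unrecorded diagonal values cost q^(kq − s); the exponent left is the number of
  -- blow-up edges.
  have h1 : q ^ (k * q * d + s) ≤ c * 3 ^ (k * n) := by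
    refine Nat.le_of_mul_le_mul_right (c := q ^ (k * q - s)) ?_ (by positivity)
    calc q ^ (k * q * d + s) * q ^ (k * q - s) = (q ^ q) ^ (k * k) := by
          rw [← pow_add, ← pow_mul]
          congr 1
          have : q * (k * k) = k * q * d + k * q := by rw [hkd]; ring
          omega
      _ ≤ (q.factorial * 3 ^ q) ^ (k * k) := Nat.pow_le_pow_left (self_pow_le_factorial_mul q) _
      _ = q.factorial ^ (k * k) * 3 ^ (k * (k * q)) := by
          rw [mul_pow, ← pow_mul]
          congr 2
          ring
      _ ≤ (c * q ^ (k * q - s)) * 3 ^ (k * n) := by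
          refine Nat.mul_le_mul (hcount.trans (Nat.mul_le_mul_right _ htrans)) ?_
          refine Nat.pow_le_pow_right (by norm_num) (Nat.mul_le_mul_left _ ?_)
          have : 2 * k * q = 2 * (k * q) := by ring
          omega
      _ = _ := by ring
  have h2 : k * q * d + s ≤ k * n := by
    have : k * n = d * n + n := by rw [hkd]; ring
    omega
  have h3 : m ≤ k * (3 * k + 1) := by
    have : k * r ≤ k * (3 * k + 1) := Nat.mul_le_mul_left _ (by omega)
    omega
  calc n ^ e = n ^ (k * q * d + s) * n ^ m := by rw [hm, pow_add]
    _ ≤ (4 * k * q) ^ (k * q * d + s) * n ^ (k * (3 * k + 1)) :=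
        Nat.mul_le_mul (Nat.pow_le_pow_left hq4 _) (Nat.pow_le_pow_right (by omega) h3)
    _ = (4 * k) ^ (k * q * d + s) * q ^ (k * q * d + s) * n ^ (k * (3 * k + 1)) := by
        rw [mul_pow]
    _ ≤ (4 * k) ^ (k * n) * (c * 3 ^ (k * n)) * n ^ (k * (3 * k + 1)) :=
        Nat.mul_le_mul_right _ (Nat.mul_le_mul (Nat.pow_le_pow_right (by omega) h2) h1)
    _ = c * (12 * k) ^ (k * n) * n ^ (k * (3 * k + 1)) := by
        rw [show 12 * k = 4 * k * 3 by ring, mul_pow (4 * k) 3]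
        ring

/-- Only integral ρ needs an argument: the edge count then rules out degree ⌊ρ⌋ + 1. -/
theorem IsNearRegular.isRealRegular {ρ : ℝ} {n e : ℕ} {G : SimpleGraph (Fin n)} (hρ : 0 ≤ ρ)
    (he : 2 * e = ⌈ρ * n⌉₊) (h : IsNearRegular ⌊ρ⌋₊ e G) : IsRealRegular ρ G := by
  classical
  have hedge : G.edgeFinset.card = e := by rw [← ncard_edgeSet, h.2]
  have hdeg : ∀ v, G.degree v = ⌊ρ⌋₊ ∨ G.degree v = ⌊ρ⌋₊ + 1 := fun v => by
    simpa only [ncard_neighborSet] using h.1 v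
  suffices hv : ∀ v, G.degree v = ⌊ρ⌋₊ ∨ G.degree v = ⌈ρ⌉₊ by
    refine ⟨fun v => ?_, ?_⟩
    · convert hv v
    · convert he
  intro v
  rcases (Nat.floor_le hρ).eq_or_lt with heq | hlt
  · left
    by_contra hne
    have hsum := G.sum_degrees_eq_twice_card_edges
    have hlt : ∑ _u : Fin n, ⌊ρ⌋₊ < ∑ u, G.degree u := Finset.sum_lt_sum
      (fun u _ => by have := hdeg u; omega)
      ⟨v, Finset.mem_univ _, by have := hdeg v; omega⟩
    rw [hsum, hedge, he] at hlt
    rw [← heq] at hlt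
    have : ⌈((⌊ρ⌋₊ : ℕ) : ℝ) * n⌉₊ = ⌊ρ⌋₊ * n := by
      rw [← Nat.cast_mul, Nat.ceil_natCast]
    simp only [Finset.sum_const, Finset.card_univ, Fintype.card_fin, smul_eq_mul,
      Nat.floor_natCast] at hlt
    rw [this, mul_comm] at hlt
    exact lt_irrefl _ hlt
  · have : ⌈ρ⌉₊ = ⌊ρ⌋₊ + 1 := by
      refine le_antisymm (Nat.ceil_le_floor_add_one ρ) ?_
      exact Nat.lt_ceil.2 hlt
    rw [this]
    exact hdeg v

/-- A lower bound for the number of `ρ`-regular graphs. -/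
theorem pow_le_ncard_isRealRegular {ρ : ℝ} {k n e : ℕ} (hρ : 0 ≤ ρ) (hk : ⌊ρ⌋₊ + 1 ≤ k)
    (hn : 6 * k + 2 ≤ n) (he : 2 * e = ⌈ρ * n⌉₊) :
    n ^ e ≤ {G : SimpleGraph (Fin n) | IsRealRegular ρ G}.ncard *
      (12 * k) ^ (k * n) * n ^ (k * (3 * k + 1)) := by
  have hle : ⌊ρ⌋₊ * n ≤ ⌈ρ * n⌉₊ := by
    have : ((⌊ρ⌋₊ * n : ℕ) : ℝ) ≤ ⌈ρ * n⌉₊ := by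
      push_cast
      exact (mul_le_mul_of_nonneg_right (Nat.floor_le hρ) (by positivity)).trans (Nat.le_ceil _)
    exact_mod_cast this
  have hge : ⌈ρ * n⌉₊ ≤ (⌊ρ⌋₊ + 1) * n := by
    refine Nat.ceil_le.2 ?_
    push_cast
    exact mul_le_mul_of_nonneg_right (Nat.lt_floor_add_one ρ).le (by positivity)
  obtain ⟨h, hh⟩ := Nat.exists_eq_add_of_le hle
  have hhn : h ≤ n := by
    rw [add_mul] at hge
    omega
  have key := pow_le_ncard_isNearRegular (k := ⌊ρ⌋₊ + 1) (n := n) (e := e) (h := h)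
    (Nat.succ_pos _) (by omega) hhn (by rw [he, hh, Nat.add_sub_cancel])
  refine key.trans ?_
  have hk0 : 0 < k := by omega
  gcongr ?_ * ?_ * ?_
  · exact Set.ncard_le_ncard (fun G hG => IsNearRegular.isRealRegular hρ he hG) (Set.toFinite _)
  · calc _ ≤ (12 * k) ^ ((⌊ρ⌋₊ + 1) * n) := Nat.pow_le_pow_left (by omega) _
      _ ≤ _ := Nat.pow_le_pow_right (by omega) (Nat.mul_le_mul_right _ hk)
  · refine Nat.pow_le_pow_right (by omega) (Nat.mul_le_mul hk (by omega))

/-! ### Parameters and numerical estimates. -/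

/-- The binomial is at most (6n/t)^t ≤ (12L·2^L)^t ≤ 2^(3Lt/2), and 3Lt/2 is about (3/4)ζn. The
remaining quarter of ζn exceeds the rounding error 1 + 3L/2, since ζn > 10L. -/
theorem two_mul_choose_lt_two_pow {n t p : ℕ} {ζ L : ℝ} (hζ : 0 < ζ) (hL : 1 ≤ L)
    (hζL : 1 / ζ = 2 ^ L) (hL' : 12 * L ≤ 2 ^ (L / 2)) (hn : 1 / ζ < ζ * n)
    (ht : ζ * n / (2 * L) ≤ t) (ht' : (t : ℝ) ≤ ζ * n / (2 * L) + 1) (htn : t ≤ n)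
    (hp : ζ * n ≤ p) : 2 * (n + t).choose n < 2 ^ p := by
  have hζn : 0 < ζ * n := (by positivity : 0 < 1 / ζ).trans hn
  have ht0 : (0 : ℝ) < t := lt_of_lt_of_le (by positivity) ht
  have hchoose : ((n + t).choose n : ℝ) ≤ 2 ^ (3 * L / 2 * t) := by
    have h1 : ((n + t).choose t : ℝ) * (t : ℝ) ^ t ≤ (3 * (n + t)) ^ t := by
      exact_mod_cast choose_mul_self_pow_le (n + t) t
    have h2 : (3 * (n + t) : ℝ) ≤ 2 ^ (3 * L / 2) * t := by
      have h3 : (t : ℝ) ≤ n := by exact_mod_cast htn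
      have h4 : (6 * n : ℝ) ≤ 12 * L * 2 ^ L * t := by
        rw [← hζL]
        calc (6 * n : ℝ) = 12 * L * (1 / ζ) * (ζ * n / (2 * L)) := by field_simp; ring
          _ ≤ _ := by gcongr
      have h5 : (2 : ℝ) ^ (3 * L / 2) = 2 ^ (L / 2) * 2 ^ L := by
        rw [← Real.rpow_add (by norm_num)]
        congr 1
        ring
      rw [h5]
      calc (3 * (n + t) : ℝ) ≤ 6 * n := by linarith
        _ ≤ _ := h4
        _ ≤ _ := by gcongr
    have h6 : ((n + t).choose t : ℝ) * (t : ℝ) ^ t ≤ 2 ^ (3 * L / 2 * t) * (t : ℝ) ^ t := by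
      refine h1.trans ((pow_le_pow_left₀ (by positivity) h2 t).trans_eq ?_)
      rw [mul_pow, Real.rpow_mul (by norm_num), Real.rpow_natCast]
    rw [Nat.choose_symm_add]
    exact le_of_mul_le_mul_right h6 (by positivity)
  have hLn : 10 * L < ζ * n := by
    have h7 : (2 : ℝ) ^ L = 2 ^ (L / 2) * 2 ^ (L / 2) := by
      rw [← Real.rpow_add (by norm_num)]
      congr 1
      ring
    have h8 : 12 * L * (12 * L) ≤ 2 ^ (L / 2) * 2 ^ (L / 2) := by gcongr
    nlinarith
  have hexp : 1 + 3 * L / 2 * t < p := by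
    have h9 : 3 * L / 2 * t ≤ 3 / 4 * (ζ * n) + 3 * L / 2 := by
      calc 3 * L / 2 * t ≤ 3 * L / 2 * (ζ * n / (2 * L) + 1) := by gcongr
        _ = _ := by field_simp; ring
    nlinarith
  have : (2 * (n + t).choose n : ℝ) < 2 ^ p := by
    calc (2 * (n + t).choose n : ℝ) ≤ 2 ^ (1 : ℝ) * 2 ^ (3 * L / 2 * t) := by
          rw [Real.rpow_one]
          gcongr
      _ = 2 ^ (1 + 3 * L / 2 * t) := by rw [Real.rpow_add (by norm_num)]
      _ < 2 ^ (p : ℝ) := Real.rpow_lt_rpow_of_exponent_lt (by norm_num) hexp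
      _ = 2 ^ p := Real.rpow_natCast _ _
  exact_mod_cast this

/-- The choice of the parameters of the blow-up colouring. -/
theorem exists_blowUp_parameters {n : ℕ} {ε ζ : ℝ} (hε : 0 < ε) (hε' : ε < 1 / 2) (hζ : 0 < ζ)
    (hL : 1 ≤ Real.logb 2 (1 / ζ))
    (hL' : 12 * Real.logb 2 (1 / ζ) ≤ 2 ^ (Real.logb 2 (1 / ζ) / 2))
    (hn : 1 ≤ n) (hT : (n : ℝ) < ζ * (n : ℝ) ^ (1 + ε) / (2 * Real.logb 2 (1 / ζ))) :
    ∃ t m p : ℕ, ζ * (n : ℝ) ^ (1 + ε) / (2 * Real.logb 2 (1 / ζ)) ≤ (t * m : ℕ) ∧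
      2 * (n + t).choose n < 2 ^ p ∧ p ≤ Fintype.card (Sym2 (Fin t)) ∧ 0 < t ∧ t ≤ n ∧
      3 * t ^ 2 ≤ n * p ∧ (p : ℝ) ≤ ζ * n + 1 ∧ (p : ℝ) ≤ 2 * (ζ * n) ∧
      (m : ℝ) ≤ 2 * (n : ℝ) ^ ε := by
  set L := Real.logb 2 (1 / ζ) with hLdef
  have hn0 : (0 : ℝ) < n := by exact_mod_cast hn
  have hn1 : (1 : ℝ) ≤ n := by exact_mod_cast hn
  have hL0 : 0 < L := by linarith
  have hζL : 1 / ζ = 2 ^ L := (Real.rpow_logb (by norm_num) (by norm_num) (by positivity)).symm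
  have hbig : 144 * L ^ 2 ≤ 1 / ζ := by
    have h7 : (2 : ℝ) ^ L = 2 ^ (L / 2) * 2 ^ (L / 2) := by
      rw [← Real.rpow_add (by norm_num)]
      congr 1
      ring
    have h8 : 12 * L * (12 * L) ≤ 2 ^ (L / 2) * 2 ^ (L / 2) := by gcongr
    rw [hζL, h7]
    linarith
  have hnε : 1 ≤ (n : ℝ) ^ ε := Real.one_le_rpow hn1 hε.le
  have hpow : (n : ℝ) ^ (1 + ε) = n * (n : ℝ) ^ ε := by
    rw [Real.rpow_add hn0, Real.rpow_one]
  have hζε : 2 * L < ζ * (n : ℝ) ^ ε := by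
    rw [lt_div_iff₀ (by positivity), hpow] at hT
    have : (n : ℝ) * (2 * L) < n * (ζ * (n : ℝ) ^ ε) := by linarith
    exact lt_of_mul_lt_mul_left this hn0.le
  -- As ε < 1/2, ζn^ε > 2L forces ζ√n > 1; square this.
  have hsq : 1 / ζ < ζ * n := by
    have h1 : 1 < ζ * (n : ℝ) ^ (1 / 2 : ℝ) := by
      have : (n : ℝ) ^ ε ≤ (n : ℝ) ^ (1 / 2 : ℝ) := Real.rpow_le_rpow_of_exponent_le hn1 hε'.le
      have := mul_le_mul_of_nonneg_left this hζ.le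
      linarith
    have h2 : (n : ℝ) ^ (1 / 2 : ℝ) * (n : ℝ) ^ (1 / 2 : ℝ) = n := by
      rw [← Real.rpow_add hn0]
      norm_num
    rw [div_lt_iff₀ hζ]
    have h3 : ζ * n * ζ = (ζ * (n : ℝ) ^ (1 / 2 : ℝ)) * (ζ * (n : ℝ) ^ (1 / 2 : ℝ)) := by
      linear_combination (-ζ ^ 2) * h2
    rw [h3]
    nlinarith
  have hζn : 144 * L ^ 2 < ζ * n := hbig.trans_lt hsq
  have hζn0 : 0 < ζ * n := by nlinarith
  have hζ3 : 144 * ζ ≤ 1 := by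
    have : 144 ≤ 1 / ζ := by nlinarith
    rwa [le_div_iff₀ hζ] at this
  set t := ⌈ζ * n / (2 * L)⌉₊ with htdef
  have ht : ζ * n / (2 * L) ≤ t := Nat.le_ceil _
  have ht' : (t : ℝ) < ζ * n / (2 * L) + 1 := Nat.ceil_lt_add_one (by positivity)
  have ht0 : 0 < t := Nat.ceil_pos.2 (by positivity)
  have htζ : (t : ℝ) ≤ ζ * n := by
    have : ζ * n / (2 * L) ≤ ζ * n / 2 :=
      div_le_div_of_nonneg_left hζn0.le (by norm_num) (by linarith)
    nlinarith
  have htn : t ≤ n := by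
    have : (t : ℝ) ≤ n := by nlinarith
    exact_mod_cast this
  set p := ⌈ζ * n⌉₊ with hpdef
  have hp : ζ * n ≤ p := Nat.le_ceil _
  have hp' : (p : ℝ) < ζ * n + 1 := Nat.ceil_lt_add_one hζn0.le
  have hp2 : (p : ℝ) ≤ 2 * (ζ * n) := by nlinarith
  refine ⟨t, ⌈(n : ℝ) ^ ε⌉₊, p, ?_, ?_, ?_, ht0, htn, ?_, hp'.le, hp2, ?_⟩
  · rw [hpow]
    push_cast
    calc ζ * (n * (n : ℝ) ^ ε) / (2 * L) = ζ * n / (2 * L) * (n : ℝ) ^ ε := by ring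
      _ ≤ _ := by
        gcongr
        exact Nat.le_ceil _
  · exact two_mul_choose_lt_two_pow hζ hL hζL hL' hsq ht ht'.le htn hp
  · rw [Sym2.card, Fintype.card_fin, Nat.choose_two_right, Nat.add_sub_cancel,
      Nat.le_div_iff_mul_le (by norm_num)]
    -- t² ≥ (ζn)²/(4L²), and ζn > 144L².
    have h1 : 36 * (ζ * n) ≤ t * t := by
      have h2 : ζ * n / (2 * L) * (ζ * n / (2 * L)) ≤ t * t := by gcongr
      refine le_trans ?_ h2
      rw [div_mul_div_comm, le_div_iff₀ (by positivity)]
      nlinarith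
    have h3 : ((p * 2 : ℕ) : ℝ) ≤ ((t + 1) * t : ℕ) := by
      push_cast
      nlinarith [(Nat.cast_nonneg t : (0 : ℝ) ≤ t)]
    exact_mod_cast h3
  · have : (3 * t ^ 2 : ℝ) ≤ n * p := by
      calc (3 * t ^ 2 : ℝ) ≤ 3 * (ζ * n) ^ 2 := by gcongr
        _ = (3 * ζ) * (n * (ζ * n)) := by ring
        _ ≤ 1 * (n * (ζ * n)) := by gcongr; linarith
        _ ≤ n * p := by rw [one_mul]; gcongr
    exact_mod_cast this
  · have := Nat.ceil_lt_add_one (zero_le_one.trans hnε)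
    linarith

/-- The three factors are at most n^n, n^(ζn+1) and (24ζn^(2ε))^e, where 24 = 3·2·2² comes from the
bounds on `p` and `m`. By `hD` and e ≥ ρn/2, the exponents of n add up to at most e + 1. Since e ≥
n, the gain (24ζ)^e is at most (24ζ)^n. -/
theorem sparse_count_le {n t m p e S : ℕ} {ε ζ ρ : ℝ} (hε' : ε < 1 / 2) (hζ : 0 < ζ)
    (hζ' : 24 * ζ ≤ 1) (hD : 0 ≤ (1 / 2 - ε) * ρ - ζ - 1) (hn : 1 ≤ n) (hp0 : 0 < p)
    (hS : S ≤ t ^ 2) (htn : t ≤ n)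
    (htp : 3 * t ^ 2 ≤ n * p) (hp : (p : ℝ) ≤ ζ * n + 1) (hp2 : (p : ℝ) ≤ 2 * (ζ * n))
    (hm : (m : ℝ) ≤ 2 * (n : ℝ) ^ ε) (hne : n ≤ e) (hρe : ρ * n ≤ 2 * e) :
    ((t ^ n * S.choose p * (p * m ^ 2).choose e : ℕ) : ℝ) ≤ n * (24 * ζ) ^ n * (n : ℝ) ^ e := by
  have hn0 : (0 : ℝ) < n := by exact_mod_cast hn
  have hn1 : (1 : ℝ) ≤ n := by exact_mod_cast hn
  have h1 : (S.choose p : ℝ) ≤ (n : ℝ) ^ (ζ * n + 1) := by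
    have h2 : S.choose p ≤ n ^ p := by
      refine Nat.le_of_mul_le_mul_right (c := p ^ p) ?_ (by positivity)
      rw [← mul_pow]
      exact (choose_mul_self_pow_le S p).trans (Nat.pow_le_pow_left (by omega) _)
    calc (S.choose p : ℝ) ≤ (n : ℝ) ^ p := by exact_mod_cast h2
      _ = (n : ℝ) ^ (p : ℝ) := (Real.rpow_natCast _ _).symm
      _ ≤ _ := Real.rpow_le_rpow_of_exponent_le hn1 hp
  have h3 : ((p * m ^ 2).choose e : ℝ) ≤ (24 * ζ) ^ n * (n : ℝ) ^ (2 * ε * e) := by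
    have h4 : ((p * m ^ 2).choose e : ℝ) * (n : ℝ) ^ e ≤ (3 * (p * m ^ 2)) ^ e := by
      have h5 := (Nat.mul_le_mul_left _ (Nat.pow_le_pow_left hne e)).trans
        (choose_mul_self_pow_le (p * m ^ 2) e)
      exact_mod_cast h5
    have h6 : (3 * (p * m ^ 2) : ℝ) ≤ 24 * ζ * (n : ℝ) ^ (2 * ε) * n := by
      have h7 : (n : ℝ) ^ (2 * ε) = (n : ℝ) ^ ε * (n : ℝ) ^ ε := by
        rw [← Real.rpow_add hn0]
        congr 1
        ring
      calc (3 * (p * m ^ 2) : ℝ) ≤ 3 * (2 * (ζ * n) * (2 * (n : ℝ) ^ ε) ^ 2) := by gcongr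
        _ = _ := by rw [h7]; ring
    have h8 : ((p * m ^ 2).choose e : ℝ) ≤ (24 * ζ * (n : ℝ) ^ (2 * ε)) ^ e := by
      refine le_of_mul_le_mul_right (h4.trans ?_) (show (0 : ℝ) < (n : ℝ) ^ e by positivity)
      rw [← mul_pow]
      exact pow_le_pow_left₀ (by positivity) h6 e
    refine h8.trans ?_
    rw [mul_pow, Real.rpow_mul hn0.le (2 * ε), Real.rpow_natCast]
    exact mul_le_mul_of_nonneg_right
      (pow_le_pow_of_le_one (by positivity) hζ' hne) (by positivity)
  have h9 : (t : ℝ) ^ n ≤ (n : ℝ) ^ (n : ℝ) := by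
    rw [Real.rpow_natCast]
    exact pow_le_pow_left₀ (by positivity) (by exact_mod_cast htn) n
  have h10 : (n : ℝ) + (ζ * n + 1) + 2 * ε * e ≤ 1 + e := by
    have h11 : (1 - 2 * ε) * (ρ * n) ≤ (1 - 2 * ε) * (2 * e) :=
      mul_le_mul_of_nonneg_left hρe (by linarith)
    have h12 := mul_nonneg hD hn0.le
    nlinarith
  push_cast
  calc (t : ℝ) ^ n * S.choose p * (p * m ^ 2).choose e
      ≤ (n : ℝ) ^ (n : ℝ) * (n : ℝ) ^ (ζ * n + 1) *
          ((24 * ζ) ^ n * (n : ℝ) ^ (2 * ε * e)) := by gcongr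
    _ = (24 * ζ) ^ n * (n : ℝ) ^ ((n : ℝ) + (ζ * n + 1) + 2 * ε * e) := by
        rw [Real.rpow_add hn0 (n + (ζ * n + 1)), Real.rpow_add hn0 (n : ℝ)]
        ring
    _ ≤ (24 * ζ) ^ n * (n : ℝ) ^ ((1 : ℝ) + e) := by
        gcongr
    _ = n * (24 * ζ) ^ n * (n : ℝ) ^ e := by
        rw [Real.rpow_add hn0, Real.rpow_one, Real.rpow_natCast]
        ring

/-! ### Uniform measure and conclusion. -/

instance SimpleGraph.instMeasurableSingletonClass {V : Type*} [Countable V] :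
    MeasurableSingletonClass (SimpleGraph V) where
  measurableSet_singleton G := by
    have : ({G} : Set (SimpleGraph V)) = SimpleGraph.edgeSet ⁻¹' {G.edgeSet} := by
      ext H
      simp
    rw [this]
    exact SimpleGraph.measurable_edgeSet (measurableSet_singleton _)

theorem uniformOn_apply_eq_ncard_div {Ω : Type*} [MeasurableSpace Ω] [MeasurableSingletonClass Ω]
    [Finite Ω] (s t : Set Ω) :
    ProbabilityTheory.uniformOn s t = ((s ∩ t).ncard : ENNReal) / (s.ncard : ENNReal) := by
  classical
  have hs := s.toFinite
  have ht := t.toFinite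
  have h := ProbabilityTheory.uniformOn_apply_finset (s := hs.toFinset) (t := ht.toFinset)
  rw [hs.coe_toFinset, ht.coe_toFinset] at h
  rw [h, Set.ncard_eq_toFinset_card _ hs, Set.ncard_eq_toFinset_card _ (hs.inter_of_left t)]
  congr 3
  ext x
  simp

theorem eventually_mul_le_two_rpow_half : ∀ᶠ L : ℝ in atTop, 12 * L ≤ 2 ^ (L / 2) := by
  -- As (log 2)/4 > 1/6, 2^(L/2) is at least (L/6 + 1)², which exceeds 12L already for L ≥ 432.
  filter_upwards [eventually_ge_atTop 480] with L hL
  have h1 : (0.69 : ℝ) < Real.log 2 := by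
    have := Real.log_two_gt_d9
    linarith
  have h2 : L / 6 + 1 ≤ Real.exp (Real.log 2 * (L / 4)) := by
    have := Real.add_one_le_exp (Real.log 2 * (L / 4))
    nlinarith
  have h3 : (2 : ℝ) ^ (L / 2) =
      Real.exp (Real.log 2 * (L / 4)) * Real.exp (Real.log 2 * (L / 4)) := by
    rw [Real.rpow_def_of_pos (by norm_num), ← Real.exp_add]
    congr 1
    ring
  rw [h3]
  have h4 : (L / 6 + 1) * (L / 6 + 1) ≤
      Real.exp (Real.log 2 * (L / 4)) * Real.exp (Real.log 2 * (L / 4)) := by gcongr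
  nlinarith

/-- The finite form of the main estimate. -/
theorem ncard_minOrderedRamsey_lt_le {n k : ℕ} {ε ζ ρ : ℝ} (hε : 0 < ε) (hε' : ε < 1 / 2)
    (hζ : 0 < ζ) (hL : 1 ≤ Real.logb 2 (1 / ζ))
    (hL' : 12 * Real.logb 2 (1 / ζ) ≤ 2 ^ (Real.logb 2 (1 / ζ) / 2))
    (hζk : 24 * ζ * (12 * k) ^ k ≤ 1 / 2) (hD : 0 ≤ (1 / 2 - ε) * ρ - ζ - 1) (hρ : 2 ≤ ρ)
    (hk : ⌊ρ⌋₊ + 1 ≤ k) (hn : 6 * k + 2 ≤ n) (heven : Even ⌈ρ * n⌉₊) :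
    (({G : SimpleGraph (Fin n) | IsRealRegular ρ G} ∩ {G | ¬ ζ * (n : ℝ) ^ (1 + ε) /
        (2 * Real.logb 2 (1 / ζ)) ≤ (minOrderedRamsey G : ℝ)}).ncard : ℝ) ≤
      (n : ℝ) ^ (k * (3 * k + 1) + 1) * (1 / 2) ^ n *
        ({G : SimpleGraph (Fin n) | IsRealRegular ρ G}.ncard : ℝ) := by
  classical
  rcases le_or_gt (ζ * (n : ℝ) ^ (1 + ε) / (2 * Real.logb 2 (1 / ζ))) n with hT | hT
  · have : {G : SimpleGraph (Fin n) | ¬ ζ * (n : ℝ) ^ (1 + ε) /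
        (2 * Real.logb 2 (1 / ζ)) ≤ (minOrderedRamsey G : ℝ)} = ∅ := by
      rw [Set.eq_empty_iff_forall_notMem]
      intro G hG
      have h := card_le_minOrderedRamsey G
      rw [Fintype.card_fin] at h
      exact hG (hT.trans (by exact_mod_cast h))
    rw [this, Set.inter_empty, Set.ncard_empty, Nat.cast_zero]
    positivity
  have hn1 : 1 ≤ n := by omega
  have hk1 : 1 ≤ k := by omega
  obtain ⟨t, m, p, hTm, hchoose, hpS, ht0, htn, htp, hp, hp2, hm⟩ :=
    exists_blowUp_parameters hε hε' hζ hL hL' hn1 hT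
  obtain ⟨e, he⟩ := heven
  have he2 : 2 * e = ⌈ρ * n⌉₊ := by omega
  have hρe : ρ * n ≤ 2 * e := by
    have := Nat.le_ceil (ρ * n)
    rw [← he2] at this
    exact_mod_cast this
  have hne : n ≤ e := by
    have h1 : (2 * n : ℝ) ≤ 2 * e :=
      (mul_le_mul_of_nonneg_right hρ (by positivity)).trans hρe
    have h2 : (n : ℝ) ≤ e := by linarith
    exact_mod_cast h2
  have hsub : ({G : SimpleGraph (Fin n) | IsRealRegular ρ G} ∩ {G | ¬ ζ * (n : ℝ) ^ (1 + ε) /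
        (2 * Real.logb 2 (1 / ζ)) ≤ (minOrderedRamsey G : ℝ)}) ⊆
      {G : SimpleGraph (Fin n) | G.edgeSet.ncard = e ∧ HasSparseQuotient G t m p} := by
    rintro G ⟨hG, hlt⟩
    refine ⟨?_, ?_⟩
    · have h1 := hG.2
      rw [← he2, ← ncard_edgeSet] at h1
      omega
    -- The ordering attaining the minimum may depend on `G`; the sparse quotient forgets it.
    · obtain ⟨ord, hord⟩ := exists_orderedRamsey_eq_minOrderedRamsey G
      refine hasSparseQuotient_of_forall_hasOrderedCopy ord G ?_ (orderedRamsey_spec ord G)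
        (by rwa [Fintype.card_fin])
      rw [← hord]
      have : (minOrderedRamsey G : ℝ) ≤ (t * m : ℕ) := (not_le.1 hlt).le.trans hTm
      exact_mod_cast this
  have hS : Fintype.card (Sym2 (Fin t)) ≤ t ^ 2 := by
    rw [Sym2.card, Fintype.card_fin, Nat.choose_two_right, Nat.add_sub_cancel]
    refine Nat.div_le_of_le_mul ?_
    nlinarith
  have hp0 : 0 < p := by
    rcases Nat.eq_zero_or_pos p with rfl | h
    · have : 0 < t ^ 2 := by positivity
      omega
    · exact h
  have hk12 : (1 : ℝ) ≤ (12 * k : ℝ) ^ k := by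
    refine one_le_pow₀ ?_
    have : (1 : ℝ) ≤ k := by exact_mod_cast hk1
    linarith
  have hζ24 : 24 * ζ ≤ 1 := by nlinarith
  have hbad : (({G : SimpleGraph (Fin n) | IsRealRegular ρ G} ∩ {G | ¬ ζ * (n : ℝ) ^ (1 + ε) /
        (2 * Real.logb 2 (1 / ζ)) ≤ (minOrderedRamsey G : ℝ)}).ncard : ℝ) ≤
      n * (24 * ζ) ^ n * (n : ℝ) ^ e := by
    refine le_trans ?_ (sparse_count_le hε' hζ hζ24 hD hn1 hp0 hS htn htp hp hp2 hm hne hρe)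
    have h2 := (Set.ncard_le_ncard hsub (Set.toFinite _)).trans (ncard_hasSparseQuotient_le hpS)
    rw [Fintype.card_fin] at h2
    exact_mod_cast h2
  have htotal : (n : ℝ) ^ e ≤ ({G : SimpleGraph (Fin n) | IsRealRegular ρ G}.ncard : ℝ) *
      (12 * k) ^ (k * n) * (n : ℝ) ^ (k * (3 * k + 1)) := by
    exact_mod_cast pow_le_ncard_isRealRegular (by linarith) hk hn he2
  refine hbad.trans ?_
  calc n * (24 * ζ) ^ n * (n : ℝ) ^ e
      ≤ n * (24 * ζ) ^ n * (({G : SimpleGraph (Fin n) | IsRealRegular ρ G}.ncard : ℝ) *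
          (12 * k) ^ (k * n) * (n : ℝ) ^ (k * (3 * k + 1))) := by gcongr
    _ = (n : ℝ) ^ (k * (3 * k + 1) + 1) * (24 * ζ * (12 * k) ^ k) ^ n *
          ({G : SimpleGraph (Fin n) | IsRealRegular ρ G}.ncard : ℝ) := by
        rw [mul_pow (24 * ζ), ← pow_mul, pow_succ]
        ring
    _ ≤ _ := by gcongr

theorem mainTheorem2 (ε ζ ρ : ℕ → ℝ)
    (hε : ∀ᶠ n in atTop, 0 < ε n)
    (hζ_pos : ∀ᶠ n in atTop, 0 < ζ n)
    (hζ : Tendsto ζ atTop (𝓝 0))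
    (hρ : ∃ C : ℝ, ∀ n : ℕ, 1 ≤ n → 1 ≤ ρ n ∧ ρ n ≤ C)
    (hlim : Tendsto
      (fun n : ℕ => ((1 / 2 - ε n) * ρ n - ζ n - 1) * (n : ℝ) * Real.logb 2 (n : ℝ)) atTop atTop) :
    Tendsto
      (fun n : ℕ => randomRealRegular (ρ n) n
        {G | ζ n * (n : ℝ) ^ (1 + ε n) / (2 * Real.logb 2 (1 / ζ n)) ≤ (minOrderedRamsey G : ℝ)})
      (atTop ⊓ 𝓟 {n : ℕ | Even ⌈ρ n * (n : ℝ)⌉₊}) (𝓝 1) := by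
  obtain ⟨C, hC⟩ := hρ
  -- One `k` for all n, so that the loss (12k)^(kn) has a fixed base, beaten by ζ → 0.
  set k := ⌊C⌋₊ + 1 with hk
  have hbound : Tendsto (fun n : ℕ => (n : ℝ) ^ (k * (3 * k + 1) + 1) * (1 / 2 : ℝ) ^ n)
      atTop (𝓝 0) :=
    tendsto_pow_const_mul_const_pow_of_abs_lt_one _ (by norm_num [abs_of_pos])
  have hlower : Tendsto (fun n : ℕ => 1 - ENNReal.ofReal
      ((n : ℝ) ^ (k * (3 * k + 1) + 1) * (1 / 2 : ℝ) ^ n)) atTop (𝓝 1) := by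
    have h := ENNReal.tendsto_ofReal hbound
    rw [ENNReal.ofReal_zero] at h
    simpa using ENNReal.Tendsto.sub tendsto_const_nhds h (Or.inl ENNReal.one_ne_top)
  have hLtop : Tendsto (fun n => Real.logb 2 (1 / ζ n)) atTop atTop := by
    refine (Real.tendsto_logb_atTop (by norm_num)).comp ?_
    simp only [one_div]
    exact tendsto_inv_nhdsGT_zero.comp
      (tendsto_nhdsWithin_iff.2 ⟨hζ, hζ_pos⟩)
  have hζk : ∀ᶠ n in atTop, 24 * ζ n * (12 * k) ^ k ≤ 1 / 2 := by
    have : Tendsto (fun n => 24 * ζ n * (12 * k : ℝ) ^ k) atTop (𝓝 (24 * 0 * (12 * k : ℝ) ^ k)) :=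
      (hζ.const_mul 24).mul_const _
    rw [mul_zero, zero_mul] at this
    exact (this.eventually_lt_const (by norm_num : (0 : ℝ) < 1 / 2)).mono fun n h => h.le
  refine tendsto_of_tendsto_of_tendsto_of_le_of_le' (hlower.mono_left inf_le_left)
    tendsto_const_nhds ?_ ?_
  · rw [eventually_inf_principal]
    filter_upwards [hε, hζ_pos, hζk, hLtop.eventually_ge_atTop 1,
      hLtop.eventually eventually_mul_le_two_rpow_half, hlim.eventually_gt_atTop 0,
      eventually_ge_atTop (6 * k + 2)] with n hε hζ hζk hL hL' hD hn heven
    have hn1 : 1 ≤ n := by omega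
    obtain ⟨hρ1, hρC⟩ := hC n hn1
    -- Positivity gives (1/2 − ε)ρ > 1, hence ε < 1/2 and ρ ≥ 2.
    have hD' : 0 < (1 / 2 - ε n) * ρ n - ζ n - 1 := by
      have h1 : 0 ≤ (n : ℝ) * Real.logb 2 n :=
        mul_nonneg (by positivity) (Real.logb_nonneg (by norm_num) (by exact_mod_cast hn1))
      rw [mul_assoc] at hD
      exact pos_of_mul_pos_left hD h1
    have hε' : ε n < 1 / 2 := by
      by_contra! h
      nlinarith
    have hρ2 : 2 ≤ ρ n := by nlinarith
    have hkρ : ⌊ρ n⌋₊ + 1 ≤ k := Nat.add_le_add_right (Nat.floor_le_floor hρC) 1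
    have key := ncard_minOrderedRamsey_lt_le hε hε' hζ hL hL' hζk hD'.le hρ2 hkρ hn heven
    set s := {G : SimpleGraph (Fin n) | IsRealRegular (ρ n) G} with hs
    set A := {G : SimpleGraph (Fin n) | ζ n * (n : ℝ) ^ (1 + ε n) /
      (2 * Real.logb 2 (1 / ζ n)) ≤ (minOrderedRamsey G : ℝ)} with hA
    -- On an empty family the uniform measure would be zero.
    have hpos : 0 < s.ncard := by
      obtain ⟨e, he⟩ := heven
      have h1 := pow_le_ncard_isRealRegular (ρ := ρ n) (e := e) (by linarith) hkρ hn
        (by rw [he]; omega)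
      refine Nat.pos_of_ne_zero fun h0 => ?_
      rw [← hs, h0, zero_mul, zero_mul] at h1
      have : 0 < n ^ e := by positivity
      omega
    have hne : s.Nonempty := (Set.ncard_pos (Set.toFinite s)).1 hpos
    have hsum := ProbabilityTheory.uniformOn_compl A (Set.toFinite s) hne
    have hcompl : ProbabilityTheory.uniformOn s Aᶜ ≤ ENNReal.ofReal
        ((n : ℝ) ^ (k * (3 * k + 1) + 1) * (1 / 2 : ℝ) ^ n) := by
      rw [uniformOn_apply_eq_ncard_div]
      refine ENNReal.div_le_of_le_mul ?_
      rw [← ENNReal.ofReal_natCast, ← ENNReal.ofReal_natCast, ← ENNReal.ofReal_mul (by positivity)]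
      exact ENNReal.ofReal_le_ofReal key
    change _ ≤ ProbabilityTheory.uniformOn s A
    rw [tsub_le_iff_right, ← hsum]
    gcongr
  · refine Eventually.of_forall fun n => ?_
    rw [randomRealRegular]
    exact MeasureTheory.prob_le_one
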